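/- Let $m\ge 1$ be a fixed integer. For every sample size $n$ let $p=p_n\ge 1$ be a dimension with $\log^2 p=o(n)$, and let $\bm Y_1,\dots,\bm Y_n$ be i.i.d. copies of a random vector in $\mathbb R^p$ of the elliptical form \[ \bm Y=\mu+\xi\,\Sigma^{1/2}\bm U , \] where $\mu\in\mathbb R^p$, $\Sigma=(\sigma_{jk})$ is a positive semidefinite $p\times p$ matrix with $\sigma_{jj}>0$ for all $j$, $\bm U$ is uniformly distributed on the unit sphere of $\mathbb R^p$, and $\xi\ge 0$ is a random variable independent of $\bm U$ with $\mathbb E\xi^2=p$ (the quantities $p,\mu,\Sigma$ and the law of $\xi$ may all depend on $n$). Put $\theta_k=p^{-k}\,\mathbb E(\xi^{2k})$, and suppose that there are constants $C,K$ not depending on $n$ such that \[ \max_{1\le j\le p}\|Y_j-\mu_j\|_{\psi_2}\le C,\qquad \theta_{2m}\le K,\qquad\text{where } \|X\|_{\psi_2}=\sup_{k\ge 1}k^{-1}(\mathbb E|X|^k)^{1/k}\ \ (k \text{ an integer}). \] Let $\hat\mu=\frac1n\sum_{i=1}^n \bm Y_i$ be the sample mean and $\hat\Sigma=\frac1n\sum_{i=1}^n(\bm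 Y_i-\hat\mu)(\bm Y_i-\hat\mu)^{\mathrm T}$ the sample covariance matrix, and consider the marginal aggregation estimator \[ \hat\theta^{\,\mathrm M}_m=\frac{1}{c_m\,n\,p}\sum_{j=1}^p\Bigl\{\frac{1}{\hat\sigma_{jj}^m}\sum_{i=1}^n(Y_{ij}-\hat\mu_j)^{2m}\Bigr\},\qquad c_m=(2m-1)!!\,(p/2)^m\,\frac{\Gamma(p/2)}{\Gamma(p/2+m)} , \] where a summand with $\hat\sigma_{jj}=0$ is read as $0$. Then, as $n\to\infty$, \[ |\hat\theta^{\,\mathrm M}_m-\theta_m|=O_{\mathbb P}(n^{-1/2}), \] that is, for every $\varepsilon>0$ there is $M>0$ with $\mathbb P\bigl(|\hat\theta^{\,\mathrm M}_m-\theta_m|>M n^{-1/2}\bigr)\le\varepsilon$ for all large $n$. No further structural condition on $\Sigma$ or on $\Omega=\Sigma^{-1}$ is needed (and $\Sigma$ need not be invertible). -/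

import Mathlib

open MeasureTheory ProbabilityTheory Filter Asymptotics Topology
open scoped ENNReal NNReal Matrix Nat

noncomputable section

/-- The uniform distribution on the unit sphere of `ℝᵖ`, as a measure on `ℝᵖ`: the surface measure,
normalized to total mass one. -/
def uniformSphere (p : ℕ) : Measure (EuclideanSpace ℝ (Fin p)) :=
  ((volume : Measure (EuclideanSpace ℝ (Fin p))).toSphere Set.univ)⁻¹ •
    ((volume : Measure (EuclideanSpace ℝ (Fin p))).toSphere.map Subtype.val)

open scoped MatrixOrder in
/-- The positive semidefinite square root of a positive semidefinite matrix. -/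
def sqrtMatrix {p : ℕ} (S : Matrix (Fin p) (Fin p) ℝ) : Matrix (Fin p) (Fin p) ℝ :=
  CFC.sqrt S

/-- The law of `μ + ξ Σ^{1/2} U`, where `ξ` has law `ν`, `U` is uniform on the unit sphere, and
`ξ` and `U` are independent. -/
def ellipticalLaw {p : ℕ} (μ : EuclideanSpace ℝ (Fin p)) (S : Matrix (Fin p) (Fin p) ℝ)
    (ν : Measure ℝ) : Measure (EuclideanSpace ℝ (Fin p)) :=
  (ν.prod (uniformSphere p)).map
    (fun x => μ + x.1 • WithLp.toLp 2 (sqrtMatrix S *ᵥ x.2.ofLp))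

/-- The scaled even moment `θ_m = p^{-m} E ξ^{2m}`, for `ξ` with law `ν`. -/
def scaledMoment (p : ℕ) (ν : Measure ℝ) (m : ℕ) : ℝ :=
  ((p : ℝ) ^ m)⁻¹ * ∫ r, r ^ (2 * m) ∂ν

/-- The norm `sup_{k ≥ 1} k⁻¹ (E |X|^k)^{1/k}`, with values in `[0, ∞]`. -/
def subGaussianNorm {Ω : Type*} [MeasurableSpace Ω] (X : Ω → ℝ) (P : Measure Ω) : ℝ≥0∞ :=
  ⨆ (k : ℕ) (_ : 1 ≤ k), (k : ℝ≥0∞)⁻¹ * eLpNorm X (k : ℝ≥0∞) P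

/-- The constant `c_m = (2m-1)!! (p/2)^m Γ(p/2) / Γ(p/2 + m)`. -/
def momentConst (p m : ℕ) : ℝ :=
  ((2 * m - 1)‼ : ℕ) * ((p : ℝ) / 2) ^ m * Real.Gamma ((p : ℝ) / 2) / Real.Gamma ((p : ℝ) / 2 + m)

/-- The sample mean vector of `y_1, …, y_n`. -/
def sampleMean {n p : ℕ} (y : Fin n → EuclideanSpace ℝ (Fin p)) : EuclideanSpace ℝ (Fin p) :=
  (n : ℝ)⁻¹ • ∑ i, y i

/-- The sample covariance matrix `n⁻¹ ∑ᵢ (yᵢ - ȳ)(yᵢ - ȳ)ᵀ`. -/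
def sampleCov {n p : ℕ} (y : Fin n → EuclideanSpace ℝ (Fin p)) : Matrix (Fin p) (Fin p) ℝ :=
  (n : ℝ)⁻¹ • ∑ i, Matrix.vecMulVec (y i - sampleMean y).ofLp (y i - sampleMean y).ofLp

/-- The marginal aggregation estimator of `θ_m` for the sample `y`, with the vector `μ` and the
diagonal entries `d j` plugged in for the mean and for the diagonal of the covariance matrix. -/
def marginalAggregation {n p : ℕ} (m : ℕ) (y : Fin n → EuclideanSpace ℝ (Fin p))
    (μ : EuclideanSpace ℝ (Fin p)) (d : Fin p → ℝ) : ℝ :=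
  1 / (momentConst p m * n * p) * ∑ j, (1 / d j ^ m * ∑ i, (y i j - μ j) ^ (2 * m))

/-- `X_n = O_P(a_n)`, where `X_n` lives on the probability space `(Ω_n, P_n)`. -/
def IsBigOInProbability {Ω : ℕ → Type*} [∀ n, MeasurableSpace (Ω n)]
    (P : ∀ n, Measure (Ω n)) (X : ∀ n, Ω n → ℝ) (a : ℕ → ℝ) : Prop :=
  ∀ ε : ℝ, 0 < ε → ∃ M : ℝ, 0 < M ∧
    ∀ᶠ n in atTop, P n {ω | M * a n < |X n ω|} ≤ ENNReal.ofReal ε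

end

/-! ### Random variables with finite moments of all orders -/

/-! The estimator is `c_m⁻¹` times the average over coordinates of self-normalized moments `T = B /
s ^ m`, where `B` and `s` are the centred empirical moments of orders `2m` and `2`. `T` is invariant
under affine maps, so each coordinate may be standardized by its true mean and variance. The
standardized variable `W` has `E W^{2k} = c_k θ_k`: a linear functional of a uniform vector on the
sphere has moments that depend only on the norm of its coefficient vector, here a row of `Σ^{1/2}`.
In particular `T` estimates `c_m θ_m`, and `E W^{4m}` is bounded uniformly in the coordinate and in
`n`.

It then suffices to prove `E|T - c_m θ_m| ≤ C / √n` for one coordinate, with `C` depending only on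
`m` and the bound on `E W^{4m}`. Expectation is linear, so the bound survives averaging over
coordinates whatever their dependence and number, and Markov's inequality ends the proof.

The danger is a small denominator. If `s ≥ 1/2`, then `T` is Lipschitz-close to its target, and the
inequality `a y ≤ t a² + y² / t` with `t = √n` turns each error into `√n` times the square of a
centred average plus `n^{-1/2}` times an empirical moment of order `4m`. If `s < 1/2`, then `T ≤
n^{m-1}` deterministically, while a small `s` forces a large deviation of an empirical mean. The
`2m`-th moments of centred averages are `O(n^{-m})`, which beats `n^{m-1}`. Both regimes are merged
in one polynomial, `errorBound`, so that only expectations of powers of averages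
(`exists_integral_sum_pow_le`) are needed. -/

/-- `X` has finite absolute moments of all orders. -/
def HasAllMoments {Ω : Type*} [MeasurableSpace Ω] (X : Ω → ℝ) (P : Measure Ω) : Prop :=
  ∀ q : ℕ, MemLp X q P

namespace HasAllMoments

variable {Ω : Type*} [MeasurableSpace Ω] {P : Measure Ω} {X Z : Ω → ℝ}

theorem integrable (h : HasAllMoments X P) : Integrable X P :=
  memLp_one_iff_integrable.1 (by simpa using h 1)

theorem add (hX : HasAllMoments X P) (hZ : HasAllMoments Z P) :
    HasAllMoments (fun ω => X ω + Z ω) P := fun q => (hX q).add (hZ q)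

theorem sub (hX : HasAllMoments X P) (hZ : HasAllMoments Z P) :
    HasAllMoments (fun ω => X ω - Z ω) P := fun q => (hX q).sub (hZ q)

theorem const_mul (hX : HasAllMoments X P) (c : ℝ) :
    HasAllMoments (fun ω => c * X ω) P := fun q => (hX q).const_mul c

theorem const [IsFiniteMeasure P] (c : ℝ) : HasAllMoments (fun _ : Ω => c) P :=
  fun _ => memLp_const c

/-- Hölder costs a doubling of the order, harmless when all orders are available; this closure is
what makes every polynomial below integrable. -/
theorem mul (hX : HasAllMoments X P) (hZ : HasAllMoments Z P) :
    HasAllMoments (fun ω => X ω * Z ω) P := by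
  intro q
  have : ENNReal.HolderTriple (2 * q : ℕ) (2 * q : ℕ) (q : ℝ≥0∞) := by
    constructor
    push_cast
    rw [← two_mul, ENNReal.mul_inv (by simp) (by simp), ← mul_assoc,
      ENNReal.mul_inv_cancel (by simp) (by simp), one_mul]
  exact (hZ (2 * q)).mul' (hX (2 * q))

theorem pow [IsFiniteMeasure P] (hX : HasAllMoments X P) (k : ℕ) :
    HasAllMoments (fun ω => X ω ^ k) P := by
  induction k with
  | zero => simpa using const 1
  | succ k ih => simpa only [pow_succ] using ih.mul hX

theorem finsetSum {ι : Type*} (s : Finset ι) {Z : ι → Ω → ℝ} (h : ∀ i ∈ s, HasAllMoments (Z i) P) :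
    HasAllMoments (fun ω => ∑ i ∈ s, Z i ω) P :=
  fun q => memLp_finsetSum s fun i hi => h i hi q

end HasAllMoments

/-! ### Moments of sums of independent centred random variables -/

/-- Second-order remainder in the binomial expansion. -/
theorem abs_add_pow_sub_sub_le (N : ℕ) : ∃ C : ℝ, 0 ≤ C ∧ ∀ x z : ℝ,
    |(x + z) ^ (N + 2) - x ^ (N + 2) - (N + 2) * x ^ (N + 1) * z| ≤ C * z ^ 2 * (|x| + |z|) ^ N := by
  induction N with
  | zero => exact ⟨1, zero_le_one, fun x z => by
      simp only [zero_add, Nat.cast_zero, pow_one, pow_zero, mul_one, one_mul]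
      rw [show (x + z) ^ 2 - x ^ 2 - 2 * x * z = z ^ 2 by ring, abs_of_nonneg (sq_nonneg z)]⟩
  | succ N ih =>
    obtain ⟨C, hC, h⟩ := ih
    refine ⟨C + (N + 2), by positivity, fun x z => ?_⟩
    -- Multiplying the previous expansion by `x + z` creates just one new second-order term.
    have e : (x + z) ^ (N + 1 + 2) - x ^ (N + 1 + 2) - ((N + 1 : ℕ) + 2) * x ^ (N + 1 + 1) * z
        = (x + z) * ((x + z) ^ (N + 2) - x ^ (N + 2) - (N + 2) * x ^ (N + 1) * z)
          + (N + 2) * (x ^ (N + 1) * z ^ 2) := by push_cast; ring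
    rw [e]
    have h1 : |x + z| ≤ |x| + |z| := abs_add_le x z
    have h2 : |x| ^ (N + 1) ≤ (|x| + |z|) ^ (N + 1) :=
      pow_le_pow_left₀ (abs_nonneg x) (le_add_of_nonneg_right (abs_nonneg z)) _
    calc _ ≤ |x + z| * |(x + z) ^ (N + 2) - x ^ (N + 2) - (N + 2) * x ^ (N + 1) * z|
          + (N + 2) * (|x| ^ (N + 1) * z ^ 2) := by
          refine (abs_add_le _ _).trans (le_of_eq ?_)
          rw [abs_mul, abs_mul, abs_mul, abs_pow x, abs_of_nonneg (sq_nonneg z),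
            abs_of_nonneg (by positivity : (0 : ℝ) ≤ N + 2)]
      _ ≤ (|x| + |z|) * (C * z ^ 2 * (|x| + |z|) ^ N)
          + (N + 2) * ((|x| + |z|) ^ (N + 1) * z ^ 2) := by
          gcongr
          exact h x z
      _ = _ := by ring

/-- The first-order term is kept exact because it will have mean zero; the remainder is split into
products whose expectations factor under independence. -/
theorem add_pow_two_mul_add_two_le (q : ℕ) : ∃ C : ℝ, 0 ≤ C ∧ ∀ x z : ℝ,
    (x + z) ^ (2 * q + 2) ≤ x ^ (2 * q + 2) + (2 * q + 2) * (x ^ (2 * q + 1) * z)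
      + C * (x ^ (2 * q) * z ^ 2 + z ^ (2 * q + 2)) := by
  obtain ⟨C, hC, h⟩ := abs_add_pow_sub_sub_le (2 * q)
  refine ⟨C * 2 ^ (2 * q - 1), by positivity, fun x z => ?_⟩
  have h1 := (le_abs_self _).trans (h x z)
  have h2 := add_pow_le (abs_nonneg x) (abs_nonneg z) (2 * q)
  rw [(even_two_mul q).pow_abs, (even_two_mul q).pow_abs] at h2
  have h3 := mul_le_mul_of_nonneg_left h2 (by positivity : 0 ≤ C * z ^ 2)
  push_cast at h1
  have e : C * z ^ 2 * (2 ^ (2 * q - 1) * (x ^ (2 * q) + z ^ (2 * q))) =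
    C * 2 ^ (2 * q - 1) * (x ^ (2 * q) * z ^ 2 + z ^ (2 * q + 2)) := by ring
  linarith

theorem pow_two_mul_le_one_add {r q : ℕ} (hr : r ≤ q) (x : ℝ) : x ^ (2 * r) ≤ 1 + x ^ (2 * q) := by
  rw [pow_mul, pow_mul]
  rcases le_total (x ^ 2) 1 with h | h
  · have := pow_le_one₀ (sq_nonneg x) h (n := r)
    have : 0 ≤ (x ^ 2) ^ q := by positivity
    linarith
  · have := pow_le_pow_right₀ h hr
    linarith

theorem HasAllMoments.integral_pow_le {Ω : Type*} [MeasurableSpace Ω] {P : Measure Ω}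
    [IsProbabilityMeasure P] {X : Ω → ℝ} (hX : HasAllMoments X P) {r q : ℕ} (hr : r ≤ q) :
    ∫ ω, X ω ^ (2 * r) ∂P ≤ 1 + ∫ ω, X ω ^ (2 * q) ∂P := by
  calc _ ≤ ∫ ω, (1 + X ω ^ (2 * q)) ∂P :=
        integral_mono (hX.pow _).integrable ((HasAllMoments.const 1).add (hX.pow _)).integrable
          fun ω => pow_two_mul_le_one_add hr _
    _ = _ := by
        rw [integral_add (integrable_const _) (hX.pow _).integrable]; simp

/-- A sum of `k` independent centred random variables with `2q`-th moments bounded by `A` has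
`2q`-th moment `O(k ^ q)`. -/
theorem exists_integral_sum_pow_le (q : ℕ) (A : ℝ) : ∃ C : ℝ, 0 ≤ C ∧
    ∀ {Ω : Type*} [MeasurableSpace Ω] (P : Measure Ω) [IsProbabilityMeasure P]
      {ι : Type} (Z : ι → Ω → ℝ), (∀ i, HasAllMoments (Z i) P) → iIndepFun Z P →
      (∀ i, ∫ ω, Z i ω ∂P = 0) → (∀ i, ∫ ω, Z i ω ^ (2 * q) ∂P ≤ A) →
      ∀ s : Finset ι, ∫ ω, (∑ i ∈ s, Z i ω) ^ (2 * q) ∂P ≤ C * (s.card : ℝ) ^ q := by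
  classical
  induction q generalizing A with
  | zero => exact ⟨1, zero_le_one, fun P _ _ Z _ _ _ _ s => by simp⟩
  | succ q ih =>
    -- Moments of order `2q` are at most one plus those of order `2q + 2`, whence the bound `1 + A`.
    obtain ⟨C, hC, hrec⟩ := ih (1 + A)
    obtain ⟨D, hD, hpt⟩ := add_pow_two_mul_add_two_le q
    refine ⟨D * (C * (1 + |A|) + |A|), by positivity, ?_⟩
    intro Ω _ P _ ι Z hZ hind h0 hA s
    have hq := hrec P Z hZ hind h0 (fun i =>
      ((hZ i).integral_pow_le q.le_succ).trans (by linarith [hA i]))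
    have hsq : ∀ i, ∫ ω, Z i ω ^ 2 ∂P ≤ 1 + |A| := by
      intro i
      have := (hZ i).integral_pow_le (Nat.le_add_left 1 q)
      rw [mul_one] at this
      linarith [hA i, le_abs_self A]
    induction s using Finset.induction_on with
    | empty => simp
    | insert i s hi ihs =>
      set T : Ω → ℝ := fun ω => ∑ j ∈ s, Z j ω with hT
      have hTm : HasAllMoments T P := HasAllMoments.finsetSum s fun j _ => hZ j
      have hTZ : IndepFun T (Z i) P := by
        have := hind.indepFun_finsetSum_of_notMem₀
          (fun j => (hZ j).integrable.aestronglyMeasurable.aemeasurable) hi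
        convert this using 1
        ext ω; simp [hT]
      -- This cancellation is the source of the exponent `q` in place of `2q`: each new summand now
      -- adds only `O(k ^ q)`.
      have hi1 : ∫ ω, T ω ^ (2 * q + 1) * Z i ω ∂P = 0 := by
        have := (hTZ.comp (measurable_id.pow_const (2 * q + 1)) measurable_id)
          |>.integral_fun_mul_eq_mul_integral
          (hTm.pow _).integrable.aestronglyMeasurable (hZ i).integrable.aestronglyMeasurable
        simp only [Function.comp, id] at this
        rw [this, h0, mul_zero]
      have hi2 : ∫ ω, T ω ^ (2 * q) * Z i ω ^ 2 ∂P ≤ C * (s.card : ℝ) ^ q * (1 + |A|) := by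
        have := (hTZ.comp (measurable_id.pow_const (2 * q)) (measurable_id.pow_const 2))
          |>.integral_fun_mul_eq_mul_integral
          (hTm.pow _).integrable.aestronglyMeasurable ((hZ i).pow 2).integrable.aestronglyMeasurable
        simp only [Function.comp, id] at this
        rw [this]
        exact mul_le_mul (hq s) (hsq i) (integral_nonneg fun ω => sq_nonneg _) (by positivity)
      have m1 := (hTm.pow (2 * q + 2)).integrable
      have m2 := (((hTm.pow (2 * q + 1)).mul (hZ i)).const_mul (2 * q + 2)).integrable
      have m3 := ((hTm.pow (2 * q)).mul ((hZ i).pow 2)).integrable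
      have m4 := ((hZ i).pow (2 * q + 2)).integrable
      have hcard : ((insert i s).card : ℝ) = s.card + 1 := by
        rw [Finset.card_insert_of_notMem hi]; push_cast; ring
      have hmain : ∫ ω, (∑ j ∈ insert i s, Z j ω) ^ (2 * (q + 1)) ∂P ≤
          ∫ ω, T ω ^ (2 * q + 2) ∂P + D * (C * (s.card : ℝ) ^ q * (1 + |A|) + |A|) := by
        calc _ = ∫ ω, (T ω + Z i ω) ^ (2 * q + 2) ∂P := by
              congr 1 with ω
              rw [Finset.sum_insert hi, add_comm]
              rfl
          _ ≤ ∫ ω, (T ω ^ (2 * q + 2) + (2 * q + 2) * (T ω ^ (2 * q + 1) * Z i ω)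
                + D * (T ω ^ (2 * q) * Z i ω ^ 2 + Z i ω ^ (2 * q + 2))) ∂P :=
              integral_mono ((hTm.add (hZ i)).pow _).integrable
                ((m1.add m2).add ((m3.add m4).const_mul D)) fun ω => hpt _ _
          _ = ∫ ω, T ω ^ (2 * q + 2) ∂P + D * (∫ ω, T ω ^ (2 * q) * Z i ω ^ 2 ∂P
                + ∫ ω, Z i ω ^ (2 * q + 2) ∂P) := by
              have e1 := integral_add (m1.add m2) ((m3.add m4).const_mul D)
              have e2 := integral_add m1 m2
              have e3 := integral_add m3 m4
              simp only [Pi.add_apply] at e1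
              rw [e1, e2, integral_const_mul, hi1, integral_const_mul, e3]
              ring
          _ ≤ _ := by
              gcongr
              exact (hA i).trans (le_abs_self A)
      refine hmain.trans ?_
      rw [hcard]
      have hs0 : (0 : ℝ) ≤ s.card := by positivity
      have hle : (s.card : ℝ) ^ q ≤ (s.card + 1 : ℝ) ^ q := by gcongr; linarith
      have hone : (1 : ℝ) ≤ (s.card + 1 : ℝ) ^ q := one_le_pow₀ (by linarith)
      have hstep : (s.card : ℝ) ^ (q + 1) + (s.card + 1 : ℝ) ^ q ≤ (s.card + 1 : ℝ) ^ (q + 1) := by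
        rw [pow_succ, pow_succ]; nlinarith
      calc _ ≤ D * (C * (1 + |A|) + |A|) * (s.card : ℝ) ^ (q + 1)
            + D * (C * (s.card + 1 : ℝ) ^ q * (1 + |A|) + |A| * (s.card + 1 : ℝ) ^ q) := by
            have h5 : |A| ≤ |A| * (s.card + 1 : ℝ) ^ q := le_mul_of_one_le_right (abs_nonneg A) hone
            refine add_le_add ihs ?_
            gcongr
        _ = D * (C * (1 + |A|) + |A|) * ((s.card : ℝ) ^ (q + 1) + (s.card + 1 : ℝ) ^ q) := by ring
        _ ≤ _ := by gcongr

/-! ### Averages over a finite sample -/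

/-- The average of `f` over a sample of size `n`. -/
noncomputable def avg {n : ℕ} (f : Fin n → ℝ) : ℝ := (n : ℝ)⁻¹ * ∑ i, f i

section avg

variable {n : ℕ} {f g : Fin n → ℝ}

theorem avg_add (f g : Fin n → ℝ) : avg (fun i => f i + g i) = avg f + avg g := by
  simp [avg, Finset.sum_add_distrib, mul_add]

theorem avg_sub (f g : Fin n → ℝ) : avg (fun i => f i - g i) = avg f - avg g := by
  simp [avg, Finset.sum_sub_distrib, mul_sub]

theorem avg_const_mul (c : ℝ) (f : Fin n → ℝ) : avg (fun i => c * f i) = c * avg f := by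
  simp only [avg, ← Finset.mul_sum]; ring

theorem avg_const (hn : 0 < n) (c : ℝ) : avg (fun _ : Fin n => c) = c := by
  have : (n : ℝ) ≠ 0 := by positivity
  simp [avg, this]

theorem avg_mono (h : ∀ i, f i ≤ g i) : avg f ≤ avg g :=
  mul_le_mul_of_nonneg_left (Finset.sum_le_sum fun i _ => h i) (by positivity)

theorem avg_nonneg (h : ∀ i, 0 ≤ f i) : 0 ≤ avg f :=
  mul_nonneg (by positivity) (Finset.sum_nonneg fun i _ => h i)

theorem abs_avg_le (f : Fin n → ℝ) : |avg f| ≤ avg fun i => |f i| := by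
  rw [avg, abs_mul, abs_of_nonneg (by positivity : (0 : ℝ) ≤ (n : ℝ)⁻¹)]
  exact mul_le_mul_of_nonneg_left (Finset.abs_sum_le_sum_abs _ _) (by positivity)

theorem avg_pow_le (hn : 0 < n) (f : Fin n → ℝ) {k : ℕ} (hk : Even k) :
    avg f ^ k ≤ avg fun i => f i ^ k := by
  have : (n : ℝ) ≠ 0 := by positivity
  have := Real.pow_arith_mean_le_arith_mean_pow_of_even Finset.univ (fun _ : Fin n => (n : ℝ)⁻¹) f
    (fun _ _ => by positivity) (by simp [this]) hk
  simpa only [← Finset.mul_sum, avg] using this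

theorem avg_sub_avg_sq (hn : 0 < n) (f : Fin n → ℝ) :
    avg (fun i => (f i - avg f) ^ 2) = avg (fun i => f i ^ 2) - avg f ^ 2 := by
  have e : (fun i => (f i - avg f) ^ 2) =
      fun i => (f i ^ 2 - 2 * avg f * f i) + avg f ^ 2 := by ext i; ring
  rw [e, avg_add, avg_sub, avg_const_mul, avg_const hn]; ring

/-- The `2m`-th powers are controlled by the second power, at the cost of a power of the
sample size. -/
theorem avg_pow_two_mul_le (hn : 0 < n) (f : Fin n → ℝ) (k : ℕ) :
    avg (fun i => f i ^ (2 * (k + 1))) ≤ (n : ℝ) ^ k * avg (fun i => f i ^ 2) ^ (k + 1) := by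
  have hn' : (n : ℝ) ≠ 0 := by positivity
  have hs : (n : ℝ) * avg (fun i => f i ^ 2) = ∑ i, f i ^ 2 := by rw [avg]; field_simp
  have hi : ∀ i, f i ^ (2 * (k + 1)) ≤ ((n : ℝ) * avg (fun i => f i ^ 2)) ^ k * f i ^ 2 := by
    intro i
    have : f i ^ 2 ≤ (n : ℝ) * avg (fun i => f i ^ 2) := by
      rw [hs]
      exact Finset.single_le_sum (f := fun i => f i ^ 2) (fun j _ => sq_nonneg _)
        (Finset.mem_univ i)
    rw [pow_mul, pow_succ]
    gcongr
  calc _ ≤ _ := avg_mono hi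
    _ = _ := by rw [avg_const_mul]; ring

end avg

/-! ### Deterministic bounds for the self-normalized moment -/

/-- Arithmetic-geometric mean inequality with a weight. -/
theorem mul_le_mul_sq_add_sq_div {t : ℝ} (ht : 0 < t) (a y : ℝ) : a * y ≤ t * a ^ 2 + y ^ 2 / t := by
  have : 0 ≤ (t * a - y) ^ 2 / t := by positivity
  have e : (t * a - y) ^ 2 / t = t * a ^ 2 - 2 * (a * y) + y ^ 2 / t := by field_simp; ring
  have : 0 ≤ t * a ^ 2 + y ^ 2 / t := by positivity
  linarith

/-- The mean value bound `|a| * 2m (|w| + |a|) ^ (2m - 1)` is split by the weighted inequality. With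
`a` an empirical mean and `t = √n`, both resulting terms have expectation of order `n^{-1/2}`. -/
theorem abs_sub_pow_sub_pow_le {m : ℕ} (hm : 1 ≤ m) {t : ℝ} (ht : 0 < t) (w a : ℝ) :
    |(w - a) ^ (2 * m) - w ^ (2 * m)| ≤
      t * a ^ 2 + 4 * m ^ 2 * 2 ^ (4 * m) * (1 + w ^ (2 * (2 * m)) + a ^ (2 * (2 * m))) / t := by
  have h1 := abs_pow_sub_pow_le (w - a) w (2 * m)
  rw [show w - a - w = -a by ring, abs_neg] at h1
  have h2 : max |w - a| |w| ≤ |w| + |a| :=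
    max_le (abs_sub w a) (le_add_of_nonneg_right (abs_nonneg a))
  have h3 : max |w - a| |w| ^ (2 * m - 1) ≤ (|w| + |a|) ^ (2 * m - 1) :=
    pow_le_pow_left₀ (le_max_of_le_right (abs_nonneg _)) h2 _
  set y : ℝ := 2 * m * (|w| + |a|) ^ (2 * m - 1) with hy
  have h4 : |(w - a) ^ (2 * m) - w ^ (2 * m)| ≤ |a| * y := by
    refine h1.trans ?_
    rw [hy, mul_assoc]
    push_cast
    gcongr
  have h5 : y ^ 2 ≤ 4 * m ^ 2 * 2 ^ (4 * m) * (1 + w ^ (2 * (2 * m)) + a ^ (2 * (2 * m))) := by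
    have e : y ^ 2 = 4 * m ^ 2 * (|w| + |a|) ^ (2 * (2 * m - 1)) := by
      rw [hy, mul_pow, ← pow_mul, mul_comm (2 * m - 1) 2]; ring
    have h6 := pow_two_mul_le_one_add (show 2 * m - 1 ≤ 2 * m by omega) (|w| + |a|)
    have h7 := add_pow_le (abs_nonneg w) (abs_nonneg a) (2 * (2 * m))
    rw [(even_two_mul (2 * m)).pow_abs, (even_two_mul (2 * m)).pow_abs] at h7
    have h8 : (2 : ℝ) ^ (2 * (2 * m) - 1) ≤ 2 ^ (4 * m) :=
      pow_le_pow_right₀ (by norm_num) (by omega)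
    have h9 : (1 : ℝ) ≤ 2 ^ (4 * m) := one_le_pow₀ (by norm_num)
    have hw : 0 ≤ w ^ (2 * (2 * m)) := (even_two_mul _).pow_nonneg w
    have ha : 0 ≤ a ^ (2 * (2 * m)) := (even_two_mul _).pow_nonneg a
    rw [e, mul_assoc (4 * (m : ℝ) ^ 2)]
    refine mul_le_mul_of_nonneg_left ?_ (by positivity)
    calc _ ≤ _ := h6
      _ ≤ 1 + 2 ^ (4 * m) * (w ^ (2 * (2 * m)) + a ^ (2 * (2 * m))) := by
        gcongr
        exact h7.trans (by gcongr)
      _ ≤ _ := by nlinarith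
  calc _ ≤ |a| * y := h4
    _ ≤ t * |a| ^ 2 + y ^ 2 / t := mul_le_mul_sq_add_sq_div ht _ _
    _ ≤ _ := by rw [sq_abs]; gcongr

theorem abs_one_sub_pow_le {m : ℕ} {t : ℝ} (ht : 0 < t) {s : ℝ} (hs : 0 ≤ s) :
    |1 - s ^ m| ≤ t * (1 - s) ^ 2 + m ^ 2 * (1 + s ^ (2 * m)) / t := by
  have h1 := abs_pow_sub_pow_le 1 s m
  rw [one_pow, abs_one, abs_of_nonneg hs] at h1
  set y : ℝ := m * max 1 s ^ (m - 1) with hy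
  have h2 : y ^ 2 ≤ m ^ 2 * (1 + s ^ (2 * m)) := by
    rw [hy, mul_pow, ← pow_mul]
    refine mul_le_mul_of_nonneg_left ?_ (by positivity)
    have hs' : 0 ≤ s ^ (2 * m) := by positivity
    rcases le_total s 1 with h | h
    · rw [max_eq_left h, one_pow]; linarith
    · rw [max_eq_right h]
      have := pow_le_pow_right₀ h (show (m - 1) * 2 ≤ 2 * m by omega)
      linarith
  calc _ ≤ |1 - s| * y := by rw [hy, ← mul_assoc]; exact h1
    _ ≤ t * |1 - s| ^ 2 + y ^ 2 / t := mul_le_mul_sq_add_sq_div ht _ _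
    _ ≤ _ := by rw [sq_abs]; gcongr

/-- The self-normalized centred empirical moment of order `2m`. -/
noncomputable def selfNormalizedMoment {n : ℕ} (m : ℕ) (w : Fin n → ℝ) : ℝ :=
  avg (fun i => (w i - avg w) ^ (2 * m)) / avg (fun i => (w i - avg w) ^ 2) ^ m

/-- Polynomial that dominates the error of the self-normalized moment. -/
noncomputable def errorBound {n : ℕ} (m : ℕ) (b t : ℝ) (w : Fin n → ℝ) : ℝ :=
  t * (avg (fun i => w i ^ (2 * m) - b)) ^ 2 + t * avg w ^ 2 + t * avg (fun i => w i ^ 2 - 1) ^ 2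
    + t * avg w ^ 4 + (1 + avg (fun i => w i ^ (2 * (2 * m)))) / t
    + (n : ℝ) ^ (m - 1) * (avg (fun i => w i ^ 2 - 1) ^ (2 * m) + avg w ^ (2 * (2 * m)))

theorem abs_div_pow_sub_le {B b s : ℝ} {m : ℕ} (hs : 1 / 2 ≤ s) (hb : 0 ≤ b) :
    |B / s ^ m - b| ≤ 2 ^ m * (|B - b| + b * |1 - s ^ m|) := by
  have hs0 : 0 < s := by linarith
  have h1 : B / s ^ m - b = (1 / s) ^ m * ((B - b) + b * (1 - s ^ m)) := by
    rw [one_div, inv_pow]; field_simp; ring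
  have h2 : 1 / s ≤ 2 := by rw [div_le_iff₀ hs0]; linarith
  rw [h1, abs_mul, abs_of_nonneg (by positivity : 0 ≤ (1 / s) ^ m)]
  gcongr
  exact (abs_add_le _ _).trans (by rw [abs_mul, abs_of_nonneg hb])

/-- Either `M ≤ 3/4`, so that `|4 (M - 1)| ≥ 1`, or `4 a ^ 2 ≥ 1`. This replaces the indicator of a
small denominator by a polynomial of high enough degree to absorb `n ^ (m - 1)`. -/
theorem one_le_pow_add_pow {M a s : ℝ} {m : ℕ} (hs : s < 1 / 2) (h : s = M - a ^ 2) :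
    1 ≤ 4 ^ (2 * m) * ((M - 1) ^ (2 * m) + a ^ (2 * (2 * m))) := by
  have e1 : (4 : ℝ) ^ (2 * m) * (M - 1) ^ (2 * m) = ((4 * (M - 1)) ^ 2) ^ m := by
    rw [← mul_pow, pow_mul]
  have e2 : (4 : ℝ) ^ (2 * m) * a ^ (2 * (2 * m)) = (4 * a ^ 2) ^ (2 * m) := by
    rw [pow_mul a, ← mul_pow]
  rw [mul_add, e1, e2]
  rcases le_total M (3 / 4) with hM | hM
  · have : 1 ≤ (4 * (M - 1)) ^ 2 := by nlinarith
    have := one_le_pow₀ this (n := m)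
    have : 0 ≤ (4 * a ^ 2) ^ (2 * m) := by positivity
    linarith
  · have : 1 ≤ 4 * a ^ 2 := by linarith
    have := one_le_pow₀ this (n := 2 * m)
    have : 0 ≤ ((4 * (M - 1)) ^ 2) ^ m := by positivity
    linarith

/-- Deterministic bound for the error of the self-normalized moment. -/
theorem exists_abs_selfNormalizedMoment_sub_le {m : ℕ} (hm : 1 ≤ m) {A : ℝ} (hA : 0 ≤ A) :
    ∃ C : ℝ, 0 ≤ C ∧ ∀ {n : ℕ}, 0 < n → ∀ {t : ℝ}, 0 < t → ∀ (w : Fin n → ℝ) {b : ℝ}, 0 ≤ b →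
      b ≤ A → |selfNormalizedMoment m w - b| ≤ C * errorBound m b t w := by
  obtain ⟨k, rfl⟩ : ∃ k, m = k + 1 := ⟨m - 1, by omega⟩
  set m := k + 1 with hmk
  set D : ℝ := 4 * m ^ 2 * 2 ^ (4 * m) with hD
  have hD0 : 0 ≤ D := by positivity
  set C₁ : ℝ := 2 ^ m * (1 + 2 * D + A * (2 + m ^ 2)) with hC₁
  have hC₁0 : 0 ≤ C₁ := by positivity
  set C₂ : ℝ := (1 + A) * 4 ^ (2 * m) with hC₂
  have hC₂0 : 0 ≤ C₂ := by positivity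
  refine ⟨C₁ + C₂, by positivity, ?_⟩
  intro n hn t ht w b hb hbA
  set a := avg w with ha
  set M := avg (fun i => w i ^ 2) with hM
  set M4 := avg (fun i => w i ^ (2 * (2 * m))) with hM4
  set B := avg (fun i => (w i - a) ^ (2 * m)) with hB
  set s := avg (fun i => (w i - a) ^ 2) with hs
  have hM1 : avg (fun i => w i ^ 2 - 1) = M - 1 := by rw [avg_sub, avg_const hn]
  have hMb : avg (fun i => w i ^ (2 * m) - b) = avg (fun i => w i ^ (2 * m)) - b := by
    rw [avg_sub, avg_const hn]
  have hsM : s = M - a ^ 2 := avg_sub_avg_sq hn w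
  have hs0 : 0 ≤ s := avg_nonneg fun i => sq_nonneg _
  have hB0 : 0 ≤ B := avg_nonneg fun i => (even_two_mul m).pow_nonneg _
  have hM40 : 0 ≤ M4 := avg_nonneg fun i => (even_two_mul _).pow_nonneg _
  -- By Jensen, all high powers of empirical means are absorbed into the single empirical moment of
  -- order `4m`.
  have ha4 : a ^ (2 * (2 * m)) ≤ M4 := avg_pow_le hn w (even_two_mul _)
  have hM2 : M ^ (2 * m) ≤ M4 := by
    have := avg_pow_le hn (fun i => w i ^ 2) (even_two_mul m)
    simpa only [← pow_mul] using this
  have hT : selfNormalizedMoment m w = B / s ^ m := rfl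
  have hE : errorBound m b t w = t * (avg (fun i => w i ^ (2 * m)) - b) ^ 2 + t * a ^ 2
      + t * (M - 1) ^ 2 + t * a ^ 4 + (1 + M4) / t
      + (n : ℝ) ^ k * ((M - 1) ^ (2 * m) + a ^ (2 * (2 * m))) := by
    rw [errorBound, hM1, hMb, hmk, Nat.add_sub_cancel]
  set R₁ : ℝ := t * (avg (fun i => w i ^ (2 * m)) - b) ^ 2 + t * a ^ 2
      + t * (M - 1) ^ 2 + t * a ^ 4 + (1 + M4) / t with hR₁
  set R₂ : ℝ := (n : ℝ) ^ k * ((M - 1) ^ (2 * m) + a ^ (2 * (2 * m))) with hR₂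
  have hR₁0 : 0 ≤ R₁ := by positivity
  have hR₂0 : 0 ≤ R₂ := by
    have := (even_two_mul m).pow_nonneg (M - 1)
    have := (even_two_mul (2 * m)).pow_nonneg a
    positivity
  rw [hT, hE]
  rcases le_or_gt (1 / 2) s with hgood | hbad
  · suffices h : |B / s ^ m - b| ≤ C₁ * R₁ from
      h.trans (mul_le_mul (by linarith) (by linarith) hR₁0 (by linarith))
    have h1 : |B - avg (fun i => w i ^ (2 * m))| ≤ t * a ^ 2 + 2 * D * ((1 + M4) / t) := by
      rw [hB, ← avg_sub]
      refine (abs_avg_le _).trans ((avg_mono fun i => abs_sub_pow_sub_pow_le hm ht (w i) a).trans ?_)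
      rw [avg_add, avg_const hn]
      refine add_le_add le_rfl ?_
      have e : (fun i => 4 * (m : ℝ) ^ 2 * 2 ^ (4 * m) *
          (1 + w i ^ (2 * (2 * m)) + a ^ (2 * (2 * m))) / t) =
          fun i => (D / t) * ((1 + a ^ (2 * (2 * m))) + w i ^ (2 * (2 * m))) := by
        ext i; rw [hD]; ring
      rw [e, avg_const_mul, avg_add, avg_const hn]
      calc _ ≤ D / t * ((1 + M4) + (1 + M4)) := by gcongr; linarith
        _ = _ := by ring
    have h2 : |avg (fun i => w i ^ (2 * m)) - b| ≤
        t * (avg (fun i => w i ^ (2 * m)) - b) ^ 2 + (1 + M4) / t := by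
      have := mul_le_mul_sq_add_sq_div ht |avg (fun i => w i ^ (2 * m)) - b| 1
      rw [mul_one, sq_abs, one_pow] at this
      refine this.trans ?_
      gcongr
      linarith
    have h3 : |1 - s ^ m| ≤ 2 * (t * (M - 1) ^ 2 + t * a ^ 4) + m ^ 2 * ((1 + M4) / t) := by
      refine (abs_one_sub_pow_le ht hs0).trans ?_
      have h4 : (1 - s) ^ 2 ≤ 2 * ((M - 1) ^ 2 + a ^ 4) := by
        rw [hsM]; nlinarith [sq_nonneg (M - 1 + a ^ 2)]
      have h5 : s ^ (2 * m) ≤ M4 :=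
        (pow_le_pow_left₀ hs0 (by rw [hsM]; linarith [sq_nonneg a]) _).trans hM2
      calc _ ≤ t * (2 * ((M - 1) ^ 2 + a ^ 4)) + m ^ 2 * (1 + M4) / t := by gcongr
        _ = _ := by ring
    have p1 : 0 ≤ t * (avg (fun i => w i ^ (2 * m)) - b) ^ 2 := by positivity
    have p2 : 0 ≤ t * a ^ 2 := by positivity
    have p3 : 0 ≤ t * (M - 1) ^ 2 := by positivity
    have p4 : 0 ≤ t * a ^ 4 := by positivity
    have p5 : 0 ≤ (1 + M4) / t := by positivity
    have h6 : |B - b| ≤ (1 + 2 * D) * R₁ := by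
      have := abs_sub_le B (avg (fun i => w i ^ (2 * m))) b
      have := mul_le_mul_of_nonneg_left (show (1 + M4) / t ≤ R₁ by linarith)
        (by positivity : 0 ≤ 2 * D)
      linarith
    have h7 : |1 - s ^ m| ≤ (2 + m ^ 2) * R₁ := by
      have hm0 : (0 : ℝ) ≤ (m : ℝ) ^ 2 := by positivity
      have := mul_le_mul_of_nonneg_left (show (1 + M4) / t ≤ R₁ by linarith) hm0
      linarith
    calc _ ≤ 2 ^ m * (|B - b| + b * |1 - s ^ m|) := abs_div_pow_sub_le hgood hb
      _ ≤ 2 ^ m * ((1 + 2 * D) * R₁ + A * ((2 + m ^ 2) * R₁)) := by gcongr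
      _ = _ := by rw [hC₁]; ring
  · suffices h : |B / s ^ m - b| ≤ C₂ * R₂ from
      h.trans (mul_le_mul (by linarith) (by linarith) hR₂0 (by linarith))
    have hnk : (1 : ℝ) ≤ (n : ℝ) ^ k := one_le_pow₀ (by exact_mod_cast hn)
    -- This includes `s = 0`, where the quotient is `0` by convention.
    have h1 : B / s ^ m ≤ (n : ℝ) ^ k :=
      div_le_of_le_mul₀ (by positivity) (by positivity) (avg_pow_two_mul_le hn _ k)
    have h2 : 0 ≤ B / s ^ m := by positivity
    have h3 : |B / s ^ m - b| ≤ (1 + A) * (n : ℝ) ^ k := by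
      have := mul_le_mul_of_nonneg_left hnk hA
      rw [abs_le]; constructor <;> linarith
    have h4 := one_le_pow_add_pow (m := m) hbad hsM
    calc _ ≤ (1 + A) * (n : ℝ) ^ k * 1 := by rw [mul_one]; exact h3
      _ ≤ (1 + A) * (n : ℝ) ^ k * (4 ^ (2 * m) * ((M - 1) ^ (2 * m) + a ^ (2 * (2 * m)))) := by
        gcongr
      _ = _ := by rw [hC₂, hR₂]; ring

/-! ### Expectation of the error bound -/

theorem HasAllMoments.avg {Ω : Type*} [MeasurableSpace Ω] {P : Measure Ω} {n : ℕ}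
    {Z : Fin n → Ω → ℝ} (h : ∀ i, HasAllMoments (Z i) P) :
    HasAllMoments (fun ω => avg fun i => Z i ω) P :=
  (HasAllMoments.finsetSum Finset.univ fun i _ => h i).const_mul _

theorem integral_avg_le {Ω : Type*} [MeasurableSpace Ω] {P : Measure Ω} {n : ℕ} (hn : 0 < n)
    {Z : Fin n → Ω → ℝ} {A : ℝ} (h : ∀ i, HasAllMoments (Z i) P) (hA : ∀ i, ∫ ω, Z i ω ∂P ≤ A) :
    ∫ ω, avg (fun i => Z i ω) ∂P ≤ A := by
  simp only [_root_.avg]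
  rw [integral_const_mul, integral_finsetSum _ fun i _ => (h i).integrable]
  exact (avg_mono hA).trans_eq (avg_const hn A)

theorem exists_integral_avg_pow_le (q : ℕ) (A : ℝ) : ∃ C : ℝ, 0 ≤ C ∧
    ∀ {Ω : Type*} [MeasurableSpace Ω] (P : Measure Ω) [IsProbabilityMeasure P]
      {n : ℕ} (Z : Fin n → Ω → ℝ), 0 < n → (∀ i, HasAllMoments (Z i) P) → iIndepFun Z P →
      (∀ i, ∫ ω, Z i ω ∂P = 0) → (∀ i, ∫ ω, Z i ω ^ (2 * q) ∂P ≤ A) →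
      ∫ ω, avg (fun i => Z i ω) ^ (2 * q) ∂P ≤ C / (n : ℝ) ^ q := by
  obtain ⟨C, hC, h⟩ := exists_integral_sum_pow_le q A
  refine ⟨C, hC, fun P _ n Z hn hZ hind h0 hA => ?_⟩
  have := h P Z hZ hind h0 hA Finset.univ
  simp only [avg, mul_pow, integral_const_mul]
  rw [Finset.card_univ, Fintype.card_fin] at this
  calc _ ≤ ((n : ℝ)⁻¹) ^ (2 * q) * (C * (n : ℝ) ^ q) := by gcongr
    _ = _ := by rw [two_mul, pow_add, inv_pow]; field_simp

theorem sub_pow_two_mul_le (x c : ℝ) (q : ℕ) :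
    (x - c) ^ (2 * q) ≤ 2 ^ (2 * q - 1) * (x ^ (2 * q) + c ^ (2 * q)) := by
  have := (even_two_mul q).add_pow_le (a := x) (b := -c)
  rwa [(even_two_mul q).neg_pow, ← sub_eq_add_neg] at this

theorem HasAllMoments.integral_sub_pow_le {Ω : Type*} [MeasurableSpace Ω] {P : Measure Ω}
    [IsProbabilityMeasure P] {X : Ω → ℝ} (hX : HasAllMoments X P) (c : ℝ) (q : ℕ) :
    ∫ ω, (X ω - c) ^ (2 * q) ∂P ≤ 2 ^ (2 * q - 1) * (∫ ω, X ω ^ (2 * q) ∂P + c ^ (2 * q)) := by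
  have hc : HasAllMoments (fun _ : Ω => c) P := .const c
  calc _ ≤ ∫ ω, 2 ^ (2 * q - 1) * (X ω ^ (2 * q) + c ^ (2 * q)) ∂P :=
        integral_mono ((hX.sub hc).pow _).integrable
          (((hX.pow _).add (.const _)).const_mul _).integrable fun ω => sub_pow_two_mul_le _ _ _
    _ = _ := by
        rw [integral_const_mul, integral_add (hX.pow _).integrable (integrable_const _)]; simp

theorem HasAllMoments.errorBound {Ω : Type*} [MeasurableSpace Ω] {P : Measure Ω}
    [IsFiniteMeasure P] {n : ℕ} {W : Fin n → Ω → ℝ} (hW : ∀ i, HasAllMoments (W i) P)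
    (m : ℕ) (b t : ℝ) : HasAllMoments (fun ω => errorBound m b t fun i => W i ω) P := by
  have hav := HasAllMoments.avg hW
  have hM := HasAllMoments.avg fun i => ((hW i).pow 2).sub (.const 1)
  have hMb := HasAllMoments.avg fun i => ((hW i).pow (2 * m)).sub (.const b)
  have hM4 := HasAllMoments.avg fun i => (hW i).pow (2 * (2 * m))
  have h := ((((((hMb.pow 2).const_mul t).add ((hav.pow 2).const_mul t)).add
    ((hM.pow 2).const_mul t)).add ((hav.pow 4).const_mul t)).add
    (((HasAllMoments.const 1).add hM4).const_mul t⁻¹)).add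
    (((hM.pow (2 * m)).add (hav.pow (2 * (2 * m)))).const_mul ((n : ℝ) ^ (m - 1)))
  convert h using 2 with ω
  rw [_root_.errorBound]
  ring

/-- The weight `√n` balances the terms: squares of centred averages have mean `O(1/n)`, the moment
of order `4m` is divided by `√n`, and the small-denominator term is `n^{m-1} O(n^{-m})`. -/
theorem exists_integral_errorBound_le {m : ℕ} (hm : 1 ≤ m) (A : ℝ) : ∃ C : ℝ, 0 ≤ C ∧
    ∀ {Ω : Type*} [MeasurableSpace Ω] (P : Measure Ω) [IsProbabilityMeasure P]
      {n : ℕ} (W : Fin n → Ω → ℝ) (b : ℝ), 0 < n → (∀ i, HasAllMoments (W i) P) → iIndepFun W P →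
      (∀ i, ∫ ω, W i ω ∂P = 0) → (∀ i, ∫ ω, W i ω ^ 2 ∂P = 1) →
      (∀ i, ∫ ω, W i ω ^ (2 * m) ∂P = b) → (∀ i, ∫ ω, W i ω ^ (2 * (2 * m)) ∂P ≤ A) →
      ∫ ω, errorBound m b (√n) (fun i => W i ω) ∂P ≤ C / √n := by
  -- The bounds inserted here come from `E W^{4m} ≤ A`: lower even moments, in particular `b`, are
  -- at most `1 + A`, and recentring costs the factor `2 ^ (2q - 1)`.
  obtain ⟨C₁, hC₁, h₁⟩ := exists_integral_avg_pow_le 1 (2 ^ (2 * 1 - 1) * (A + (1 + A) ^ (2 * 1)))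
  obtain ⟨C₂, hC₂, h₂⟩ := exists_integral_avg_pow_le 1 1
  obtain ⟨C₃, hC₃, h₃⟩ := exists_integral_avg_pow_le 1 (2 ^ (2 * 1 - 1) * (1 + A + 1 ^ (2 * 1)))
  obtain ⟨C₄, hC₄, h₄⟩ := exists_integral_avg_pow_le 2 (1 + A)
  obtain ⟨C₅, hC₅, h₅⟩ := exists_integral_avg_pow_le m (2 ^ (2 * m - 1) * (A + 1 ^ (2 * m)))
  obtain ⟨C₆, hC₆, h₆⟩ := exists_integral_avg_pow_le (2 * m) A
  refine ⟨C₁ + C₂ + C₃ + C₄ + (1 + |A|) + (C₅ + C₆), by positivity, ?_⟩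
  intro Ω _ P _ n W b hn hW hind h0 hone hb hA
  have hA0 : 0 ≤ A := (integral_nonneg fun ω => (even_two_mul _).pow_nonneg _).trans (hA ⟨0, hn⟩)
  have hb0 : 0 ≤ b :=
    (integral_nonneg fun ω => (even_two_mul _).pow_nonneg _).trans_eq (hb ⟨0, hn⟩)
  have hbA : b ≤ 1 + A := by
    have := (hW ⟨0, hn⟩).integral_pow_le (show m ≤ 2 * m by omega)
    rw [hb] at this
    linarith [hA ⟨0, hn⟩]
  have hWb : ∀ i, HasAllMoments (fun ω => W i ω ^ (2 * m) - b) P :=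
    fun i => ((hW i).pow _).sub (.const b)
  have hW1 : ∀ i, HasAllMoments (fun ω => W i ω ^ 2 - 1) P :=
    fun i => ((hW i).pow _).sub (.const 1)
  have hindb : iIndepFun (fun i ω => W i ω ^ (2 * m) - b) P :=
    hind.comp (fun _ x => x ^ (2 * m) - b) fun _ => by fun_prop
  have hind1 : iIndepFun (fun i ω => W i ω ^ 2 - 1) P :=
    hind.comp (fun _ x => x ^ 2 - 1) fun _ => by fun_prop
  have h0b : ∀ i, ∫ ω, (W i ω ^ (2 * m) - b) ∂P = 0 := fun i => by
    rw [integral_sub ((hW i).pow _).integrable (integrable_const _), hb]; simp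
  have h01 : ∀ i, ∫ ω, (W i ω ^ 2 - 1) ∂P = 0 := fun i => by
    rw [integral_sub ((hW i).pow _).integrable (integrable_const _), hone]; simp
  have hav := HasAllMoments.avg hW
  have hM := HasAllMoments.avg hW1
  have hMb := HasAllMoments.avg hWb
  have hM4 := HasAllMoments.avg fun i => (hW i).pow (2 * (2 * m))
  have e₁ := h₁ P _ hn hWb hindb h0b fun i => by
    refine (((hW i).pow (2 * m)).integral_sub_pow_le b 1).trans ?_
    simp only [← pow_mul]
    gcongr
    rw [mul_one, mul_comm]
    exact hA i
  have e₂ := h₂ P _ hn hW hind h0 fun i => by rw [mul_one, hone]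
  have hW4 : ∀ i, ∫ ω, W i ω ^ (2 * 2) ∂P ≤ 1 + A := fun i =>
    ((hW i).integral_pow_le (show 2 ≤ 2 * m by omega)).trans (by linarith [hA i])
  have e₃ := h₃ P _ hn hW1 hind1 h01 fun i => by
    refine (((hW i).pow 2).integral_sub_pow_le 1 1).trans ?_
    simp only [← pow_mul]
    gcongr
    exact hW4 i
  have e₄ := h₄ P _ hn hW hind h0 hW4
  have e₅ := h₅ P _ hn hW1 hind1 h01 fun i => by
    refine (((hW i).pow 2).integral_sub_pow_le 1 m).trans ?_
    simp only [← pow_mul]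
    gcongr
    exact hA i
  have e₆ := h₆ P _ hn hW hind h0 hA
  have e₇ := integral_avg_le hn (fun i => (hW i).pow (2 * (2 * m))) hA
  set t := √(n : ℝ) with ht
  have ht2 : t ^ 2 = n := Real.sq_sqrt (by positivity)
  have hn1 : (1 : ℝ) ≤ n := by exact_mod_cast hn
  have ht1 : 1 ≤ t := Real.one_le_sqrt.2 hn1
  have ht0 : 0 < t := by linarith
  have i₁ := ((hMb.pow 2).const_mul t).integrable
  have i₂ := ((hav.pow 2).const_mul t).integrable
  have i₃ := ((hM.pow 2).const_mul t).integrable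
  have i₄ := ((hav.pow 4).const_mul t).integrable
  have i₅ := (((HasAllMoments.const (P := P) 1).add hM4).const_mul t⁻¹).integrable
  have i₆ := (((hM.pow (2 * m)).add (hav.pow (2 * (2 * m)))).const_mul
    ((n : ℝ) ^ (m - 1))).integrable
  have split : ∫ ω, errorBound m b t (fun i => W i ω) ∂P =
      t * ∫ ω, avg (fun i => W i ω ^ (2 * m) - b) ^ 2 ∂P + t * ∫ ω, avg (fun i => W i ω) ^ 2 ∂P
      + t * ∫ ω, avg (fun i => W i ω ^ 2 - 1) ^ 2 ∂P + t * ∫ ω, avg (fun i => W i ω) ^ 4 ∂P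
      + t⁻¹ * (1 + ∫ ω, avg (fun i => W i ω ^ (2 * (2 * m))) ∂P)
      + (n : ℝ) ^ (m - 1) * (∫ ω, avg (fun i => W i ω ^ 2 - 1) ^ (2 * m) ∂P
        + ∫ ω, avg (fun i => W i ω) ^ (2 * (2 * m)) ∂P) := by
    have s₁ := integral_add i₁ i₂
    have s₂ := integral_add (i₁.add i₂) i₃
    have s₃ := integral_add ((i₁.add i₂).add i₃) i₄
    have s₄ := integral_add (((i₁.add i₂).add i₃).add i₄) i₅
    have s₅ := integral_add ((((i₁.add i₂).add i₃).add i₄).add i₅) i₆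
    have s₆ := integral_add (integrable_const (μ := P) (1 : ℝ)) hM4.integrable
    have s₇ := integral_add (hM.pow (2 * m)).integrable (hav.pow (2 * (2 * m))).integrable
    simp only [Pi.add_apply] at s₁ s₂ s₃ s₄ s₅ s₆ s₇
    simp only [integral_const_mul] at s₁ s₂ s₃ s₄ s₅ s₆ s₇
    rw [s₄, s₃, s₂, s₁, s₆, s₇, integral_const, probReal_univ, one_smul] at s₅
    rw [← s₅]
    congr 1 with ω
    rw [errorBound]
    ring
  have small : ∀ C : ℝ, t * (C / (n : ℝ) ^ 1) = C / t := fun C => by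
    rw [pow_one, ← ht2]; field_simp
  have small' : ∀ C : ℝ, 0 ≤ C → t * (C / (n : ℝ) ^ 2) ≤ C / t := fun C hC => by
    rw [← small]
    gcongr
    norm_num
  have small'' : ∀ C : ℝ, 0 ≤ C → (n : ℝ) ^ (m - 1) * (C / (n : ℝ) ^ m) ≤ C / t := fun C hC => by
    obtain ⟨k, rfl⟩ : ∃ k, m = k + 1 := ⟨m - 1, by omega⟩
    have : (n : ℝ) ^ (k + 1 - 1) * (C / (n : ℝ) ^ (k + 1)) = C / n := by
      rw [Nat.add_sub_cancel, pow_succ]; field_simp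
    rw [this, ← ht2]
    gcongr
    nlinarith
  have hn2 : C₆ / (n : ℝ) ^ (2 * m) ≤ C₆ / (n : ℝ) ^ m := by
    gcongr
    omega
  rw [split]
  calc _ ≤ t * (C₁ / (n : ℝ) ^ 1) + t * (C₂ / (n : ℝ) ^ 1) + t * (C₃ / (n : ℝ) ^ 1)
        + t * (C₄ / (n : ℝ) ^ 2) + t⁻¹ * (1 + |A|)
        + (n : ℝ) ^ (m - 1) * (C₅ / (n : ℝ) ^ m + C₆ / (n : ℝ) ^ m) := by
        gcongr
        · exact e₇.trans (le_abs_self A)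
        · exact e₆.trans hn2
    _ ≤ C₁ / t + C₂ / t + C₃ / t + C₄ / t + (1 + |A|) / t + (C₅ + C₆) / t := by
        rw [small, small, small, ← add_div C₅, inv_mul_eq_div]
        gcongr
        · exact small' C₄ hC₄
        · exact small'' (C₅ + C₆) (by positivity)
    _ = _ := by ring

/-- For i.i.d. standardized variables with bounded moment of order `4m`, the self-normalized moment
of order `2m` differs from the true one by an error dominated by an integrable variable of
expectation `O(n ^ (-1/2))`. -/
theorem exists_abs_selfNormalizedMoment_sub_le_of_iIndepFun {m : ℕ} (hm : 1 ≤ m) (A : ℝ) :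
    ∃ C : ℝ, 0 ≤ C ∧
    ∀ {Ω : Type*} [MeasurableSpace Ω] (P : Measure Ω) [IsProbabilityMeasure P]
      {n : ℕ} (W : Fin n → Ω → ℝ) (b : ℝ), 0 < n → (∀ i, HasAllMoments (W i) P) → iIndepFun W P →
      (∀ i, ∫ ω, W i ω ∂P = 0) → (∀ i, ∫ ω, W i ω ^ 2 ∂P = 1) →
      (∀ i, ∫ ω, W i ω ^ (2 * m) ∂P = b) → (∀ i, ∫ ω, W i ω ^ (2 * (2 * m)) ∂P ≤ A) →
      ∃ D : Ω → ℝ, Integrable D P ∧ ∫ ω, D ω ∂P ≤ C / √n ∧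
        ∀ ω, |selfNormalizedMoment m (fun i => W i ω) - b| ≤ D ω := by
  obtain ⟨C₁, hC₁, h₁⟩ := exists_abs_selfNormalizedMoment_sub_le hm
    (by positivity : 0 ≤ 1 + |A|)
  obtain ⟨C₂, hC₂, h₂⟩ := exists_integral_errorBound_le hm A
  refine ⟨C₁ * C₂, by positivity, fun P _ n W b hn hW hind h0 hone hb hA => ?_⟩
  have hb0 : 0 ≤ b :=
    (integral_nonneg fun ω => (even_two_mul _).pow_nonneg _).trans_eq (hb ⟨0, hn⟩)
  have hbA : b ≤ 1 + |A| := by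
    have := (hW ⟨0, hn⟩).integral_pow_le (show m ≤ 2 * m by omega)
    rw [hb] at this
    linarith [hA ⟨0, hn⟩, le_abs_self A]
  refine ⟨fun ω => C₁ * errorBound m b (√n) (fun i => W i ω),
    ((HasAllMoments.errorBound hW m b _).const_mul _).integrable, ?_,
    fun ω => h₁ hn (by positivity) _ hb0 hbA⟩
  rw [integral_const_mul, mul_div_assoc]
  gcongr
  exact h₂ P W b hn hW hind h0 hone hb hA

/-! ### Moments of linear functionals on the sphere -/

section Sphere

variable {E : Type*} [NormedAddCommGroup E] [InnerProductSpace ℝ E] [FiniteDimensional ℝ E]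
  [MeasurableSpace E] [BorelSpace E]

theorem integral_volumeIoiPow (d : ℕ) (g : ℝ → ℝ) :
    ∫ r : Set.Ioi (0 : ℝ), g r ∂(Measure.volumeIoiPow d) = ∫ r in Set.Ioi (0 : ℝ), r ^ d * g r := by
  simp only [Measure.volumeIoiPow, ENNReal.ofReal]
  rw [integral_withDensity_eq_integral_smul,
    integral_subtype_comap measurableSet_Ioi fun a ↦ Real.toNNReal (a ^ d) • g a,
    setIntegral_congr_fun measurableSet_Ioi fun x hx ↦ ?_]
  · rw [NNReal.smul_def, Real.coe_toNNReal _ (pow_nonneg (le_of_lt hx) _), smul_eq_mul]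
  · exact (measurable_subtype_coe.pow_const _).real_toNNReal

theorem integral_Ioi_pow_mul_exp_neg_sq (k : ℕ) :
    ∫ r in Set.Ioi (0 : ℝ), r ^ k * Real.exp (-r ^ 2) = Real.Gamma ((k + 1) / 2) / 2 := by
  have h := integral_rpow_mul_exp_neg_rpow (p := 2) (q := k) two_pos
    (by linarith [(Nat.cast_nonneg k : (0 : ℝ) ≤ k)])
  simp only [Real.rpow_natCast, Real.rpow_two] at h
  rw [h]; ring

theorem integral_pow_two_mul_mul_exp_neg_sq (j : ℕ) :
    ∫ x : ℝ, x ^ (2 * j) * Real.exp (-x ^ 2) = Real.Gamma (j + 1 / 2) := by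
  have h := integral_comp_abs (f := fun x => x ^ (2 * j) * Real.exp (-x ^ 2))
  simp only [(even_two_mul j).pow_abs, sq_abs] at h
  rw [h, integral_Ioi_pow_mul_exp_neg_sq]
  push_cast
  rw [show ((2 : ℝ) * j + 1) / 2 = j + 1 / 2 by ring]
  ring

/-- Polar coordinates separate the homogeneous integrand into angular and radial factors, so
spherical moments are quotients of Gaussian integrals by Gamma values. -/
theorem integral_inner_pow_mul_exp_neg_norm_sq [Nontrivial E] (a : E) (k : ℕ) :
    ∫ x, inner ℝ a x ^ k * Real.exp (-‖x‖ ^ 2) =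
      (∫ u : Metric.sphere (0 : E) 1, inner ℝ a (u : E) ^ k ∂(volume : Measure E).toSphere) *
        (Real.Gamma ((Module.finrank ℝ E + k) / 2) / 2) := by
  have hfin : 1 ≤ Module.finrank ℝ E := Module.finrank_pos
  set f : E → ℝ := fun x => inner ℝ a x ^ k * Real.exp (-‖x‖ ^ 2) with hf
  set g : Metric.sphere (0 : E) 1 × Set.Ioi (0 : ℝ) → ℝ := fun z =>
    inner ℝ a (z.1 : E) ^ k * ((z.2 : ℝ) ^ k * Real.exp (-(z.2 : ℝ) ^ 2)) with hg
  have h1 : ∫ x, f x = ∫ x : ({(0)}ᶜ : Set E), f x ∂((volume : Measure E).comap (↑)) := by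
    rw [integral_subtype_comap (measurableSet_singleton _).compl f,
      restrict_compl_singleton]
  have h2 := (volume : Measure E).measurePreserving_homeomorphUnitSphereProd.integral_comp
        (Homeomorph.measurableEmbedding _) g
  have h3 : ∀ x : ({(0)}ᶜ : Set E), g (homeomorphUnitSphereProd E x) = f x := by
    intro x
    have hx : ‖(x : E)‖ ≠ 0 := norm_ne_zero_iff.2 x.2
    simp only [hg, hf, homeomorphUnitSphereProd_apply_snd_coe,
      homeomorphUnitSphereProd_apply_fst_coe, inner_smul_right]
    rw [← mul_assoc, ← mul_pow, mul_right_comm, inv_mul_cancel₀ hx, one_mul]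
  simp only [h3] at h2
  rw [h1, h2, hg, integral_prod_mul (fun u : Metric.sphere (0 : E) 1 => inner ℝ a (u : E) ^ k)
    (fun r : Set.Ioi (0 : ℝ) => (r : ℝ) ^ k * Real.exp (-(r : ℝ) ^ 2)),
    integral_volumeIoiPow _ fun r => r ^ k * Real.exp (-r ^ 2)]
  congr 1
  have h4 := integral_Ioi_pow_mul_exp_neg_sq (Module.finrank ℝ E - 1 + k)
  simp only [pow_add, mul_assoc] at h4
  rw [h4]
  push_cast [hfin]
  congr 3
  ring

end Sphere

/-- The Gaussian weight factors over the coordinates. -/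
theorem integral_coord_pow_mul_exp_neg_norm_sq {p : ℕ} (l : Fin p) (j : ℕ) :
    ∫ x : EuclideanSpace ℝ (Fin p), x l ^ (2 * j) * Real.exp (-‖x‖ ^ 2) =
      Real.Gamma (j + 1 / 2) * Real.Gamma (1 / 2) ^ (p - 1) := by
  set F : Fin p → ℝ → ℝ := fun i x =>
    x ^ (2 * if i = l then j else 0) * Real.exp (-x ^ 2) with hF
  have h1 := (EuclideanSpace.volume_preserving_symm_measurableEquiv_toLp (Fin p)).integral_comp'
    (fun x : Fin p → ℝ => ∏ i, F i (x i))
  rw [integral_fintype_prod_volume_eq_prod] at h1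
  have h2 : ∀ x : EuclideanSpace ℝ (Fin p),
      ∏ i, F i ((MeasurableEquiv.toLp 2 (Fin p → ℝ)).symm x i) =
        x l ^ (2 * j) * Real.exp (-‖x‖ ^ 2) := by
    intro x
    simp only [hF, Finset.prod_mul_distrib, ← Real.exp_sum, EuclideanSpace.norm_sq_eq,
      Finset.sum_neg_distrib, Real.norm_eq_abs, sq_abs]
    congr 1
    rw [Finset.prod_eq_single l]
    · simp
    · intro i _ hi; simp [hi]
    · simp
  simp only [h2] at h1
  rw [h1]
  simp only [hF, integral_pow_two_mul_mul_exp_neg_sq]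
  rw [← Finset.mul_prod_erase _ _ (Finset.mem_univ l)]
  congr 1
  · simp
  · rw [Finset.prod_congr rfl (g := fun _ => Real.Gamma (1 / 2))]
    · simp
    · intro i hi; simp [Finset.ne_of_mem_erase hi]

theorem integral_inner_pow_two_mul_mul_exp_neg_norm_sq {p : ℕ} (hp : 0 < p)
    (a : EuclideanSpace ℝ (Fin p)) (j : ℕ) :
    ∫ x : EuclideanSpace ℝ (Fin p), inner ℝ a x ^ (2 * j) * Real.exp (-‖x‖ ^ 2) =
      ‖a‖ ^ (2 * j) * (Real.Gamma (j + 1 / 2) * Real.Gamma (1 / 2) ^ (p - 1)) := by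
  set e : EuclideanSpace ℝ (Fin p) := EuclideanSpace.single ⟨0, hp⟩ 1 with he
  have hnorm : ‖‖a‖ • e‖ = ‖a‖ := by simp [he, norm_smul]
  -- Rotation invariance: this isometry sends `‖a‖ • e` to `a`, which reduces the claim to one
  -- coordinate.
  set ρ := (ℝ ∙ (‖a‖ • e - a))ᗮ.reflection
  have hρa : ρ (‖a‖ • e) = a := Submodule.reflection_sub hnorm
  have h := (LinearIsometryEquiv.measurePreserving ρ).integral_comp
    ρ.toHomeomorph.measurableEmbedding
    (fun x => inner ℝ a x ^ (2 * j) * Real.exp (-‖x‖ ^ 2))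
  rw [← h, ← integral_coord_pow_mul_exp_neg_norm_sq ⟨0, hp⟩ j, ← integral_const_mul]
  congr 1 with x
  nth_rw 1 [← hρa]
  rw [LinearIsometryEquiv.inner_map_map, LinearIsometryEquiv.norm_map, inner_smul_left, he,
    EuclideanSpace.inner_single_left]
  simp [mul_pow, mul_assoc]

theorem integral_uniformSphere {p : ℕ} (g : EuclideanSpace ℝ (Fin p) → ℝ) (hg : Measurable g) :
    ∫ u, g u ∂(uniformSphere p) =
      ((volume : Measure (EuclideanSpace ℝ (Fin p))).toSphere.real Set.univ)⁻¹ *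
        ∫ u : Metric.sphere (0 : EuclideanSpace ℝ (Fin p)) 1, g u ∂(volume : Measure _).toSphere := by
  rw [uniformSphere, integral_smul_measure, integral_map measurable_subtype_coe.aemeasurable
    hg.aestronglyMeasurable, smul_eq_mul, ENNReal.toReal_inv]
  rfl

theorem isProbabilityMeasure_uniformSphere {p : ℕ} (hp : 0 < p) :
    IsProbabilityMeasure (uniformSphere p) := by
  have : Nonempty (Fin p) := ⟨⟨0, hp⟩⟩
  constructor
  rw [uniformSphere, Measure.smul_apply, Measure.map_apply measurable_subtype_coe .univ,
    Set.preimage_univ, smul_eq_mul]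
  exact ENNReal.inv_mul_cancel
    (Measure.measure_univ_ne_zero.2 (Measure.toSphere_ne_zero
      (volume : Measure (EuclideanSpace ℝ (Fin p))))) (measure_ne_top _ _)

theorem integral_inner_uniformSphere {p : ℕ} (hp : 0 < p) (a : EuclideanSpace ℝ (Fin p)) :
    ∫ u, inner ℝ a u ∂(uniformSphere p) = 0 := by
  have : Nonempty (Fin p) := ⟨⟨0, hp⟩⟩
  rw [integral_uniformSphere _ (by fun_prop)]
  have h := integral_inner_pow_mul_exp_neg_norm_sq a 1
  have h0 : ∫ x : EuclideanSpace ℝ (Fin p), inner ℝ a x ^ 1 * Real.exp (-‖x‖ ^ 2) = 0 := by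
    have := integral_neg_eq_self
      (fun x : EuclideanSpace ℝ (Fin p) => inner ℝ a x ^ 1 * Real.exp (-‖x‖ ^ 2)) volume
    simp only [pow_one, inner_neg_right, norm_neg, neg_mul, integral_neg] at this ⊢
    linarith
  rw [h0] at h
  have hG : 0 < Real.Gamma ((Module.finrank ℝ (EuclideanSpace ℝ (Fin p)) + (1 : ℕ)) / 2) :=
    Real.Gamma_pos_of_pos (by positivity)
  have := (mul_eq_zero.1 h.symm).resolve_right (by positivity)
  simp only [pow_one] at this
  rw [this, mul_zero]

theorem integral_inner_pow_uniformSphere {p : ℕ} (hp : 0 < p) (a : EuclideanSpace ℝ (Fin p))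
    (j : ℕ) :
    ∫ u, inner ℝ a u ^ (2 * j) ∂(uniformSphere p) =
      momentConst p j / (p : ℝ) ^ j * ‖a‖ ^ (2 * j) := by
  have : Nonempty (Fin p) := ⟨⟨0, hp⟩⟩
  rw [integral_uniformSphere _ (by fun_prop)]
  have h := integral_inner_pow_mul_exp_neg_norm_sq a (2 * j)
  -- Exponent zero gives the total surface mass, hence the normalization, from the same identity.
  have h0 := integral_inner_pow_mul_exp_neg_norm_sq a (2 * 0)
  rw [integral_inner_pow_two_mul_mul_exp_neg_norm_sq hp, finrank_euclideanSpace_fin] at h h0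
  simp only [mul_zero, pow_zero, integral_const, smul_eq_mul, mul_one, one_mul,
    Nat.cast_zero, add_zero, zero_add] at h0
  set V := (volume : Measure (EuclideanSpace ℝ (Fin p))).toSphere.real Set.univ
  set I := ∫ u : Metric.sphere (0 : EuclideanSpace ℝ (Fin p)) 1,
    inner ℝ a (u : EuclideanSpace ℝ (Fin p)) ^ (2 * j) ∂(volume : Measure _).toSphere
  have hp' : (0 : ℝ) < p := by positivity
  have g1 : 0 < Real.Gamma ((p : ℝ) / 2) := Real.Gamma_pos_of_pos (by positivity)
  have g2 : 0 < Real.Gamma ((p : ℝ) / 2 + j) := Real.Gamma_pos_of_pos (by positivity)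
  have g3 : 0 < Real.Gamma (1 / 2) := Real.Gamma_pos_of_pos (by positivity)
  have g4 : 0 < Real.Gamma (1 / 2) ^ (p - 1) := by positivity
  have e : ((p : ℝ) + (2 * j : ℕ)) / 2 = p / 2 + j := by push_cast; ring
  rw [e, Real.Gamma_nat_add_half, ← Real.Gamma_one_half_eq] at h
  have hV : V = Real.Gamma (1 / 2) * Real.Gamma (1 / 2) ^ (p - 1) / (Real.Gamma (p / 2) / 2) := by
    rw [h0]; field_simp
  have hI : I = ‖a‖ ^ (2 * j) * (((2 * j - 1)‼ : ℕ) * Real.Gamma (1 / 2) / 2 ^ j *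
      Real.Gamma (1 / 2) ^ (p - 1)) / (Real.Gamma (p / 2 + j) / 2) := by
    rw [h]; field_simp
  rw [hV, hI, momentConst, div_pow]
  field_simp

/-! ### Moments of the elliptical law -/

section Elliptical

/-- The square root is symmetric and squares to `S`, so invertibility plays no role. -/
theorem sqrtMatrix_row_norm_sq {p : ℕ} {S : Matrix (Fin p) (Fin p) ℝ} (hS : S.PosSemidef)
    (j : Fin p) : ‖WithLp.toLp 2 (sqrtMatrix S j)‖ ^ 2 = S j j := by
  open scoped MatrixOrder in
  have h1 : sqrtMatrix S * sqrtMatrix S = S :=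
    CFC.sqrt_mul_sqrt_self S (Matrix.nonneg_iff_posSemidef.2 hS)
  open scoped MatrixOrder in
  have h2 : (sqrtMatrix S).IsHermitian :=
    (Matrix.nonneg_iff_posSemidef.1 (CFC.sqrt_nonneg S)).isHermitian
  rw [EuclideanSpace.norm_sq_eq]
  nth_rw 2 [← h1]
  rw [Matrix.mul_apply]
  refine Finset.sum_congr rfl fun l _ => ?_
  rw [Real.norm_eq_abs, sq_abs, sq, ← h2.apply l j]
  simp

variable {p : ℕ} {μ : EuclideanSpace ℝ (Fin p)} {S : Matrix (Fin p) (Fin p) ℝ} {ν : Measure ℝ}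

theorem sqrtMatrix_mulVec_apply (S : Matrix (Fin p) (Fin p) ℝ) (u : EuclideanSpace ℝ (Fin p))
    (j : Fin p) :
    (sqrtMatrix S *ᵥ u.ofLp) j = inner ℝ (WithLp.toLp 2 (sqrtMatrix S j)) u := by
  rw [EuclideanSpace.inner_eq_star_dotProduct, Matrix.mulVec, dotProduct_comm]
  simp

theorem measurable_ellipticalMap (μ : EuclideanSpace ℝ (Fin p)) (S : Matrix (Fin p) (Fin p) ℝ) :
    Measurable (fun x : ℝ × EuclideanSpace ℝ (Fin p) =>
      μ + x.1 • WithLp.toLp 2 (sqrtMatrix S *ᵥ x.2.ofLp)) := by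
  have : Continuous (fun x : ℝ × EuclideanSpace ℝ (Fin p) =>
      μ + x.1 • WithLp.toLp 2 (sqrtMatrix S *ᵥ x.2.ofLp)) := by fun_prop
  exact this.measurable

theorem integral_ellipticalLaw_coord (g : ℝ → ℝ) (hg : Measurable g) (j : Fin p) :
    ∫ y, g (y j - μ j) ∂(ellipticalLaw μ S ν) =
      ∫ x : ℝ × EuclideanSpace ℝ (Fin p), g (x.1 * inner ℝ (WithLp.toLp 2 (sqrtMatrix S j)) x.2)
        ∂(ν.prod (uniformSphere p)) := by
  rw [ellipticalLaw, integral_map (measurable_ellipticalMap μ S).aemeasurable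
    (by exact (hg.comp (by fun_prop)).aestronglyMeasurable)]
  simp [sqrtMatrix_mulVec_apply]

variable [IsProbabilityMeasure ν]

theorem integral_ellipticalLaw_coord_sub (hp : 0 < p) (j : Fin p) :
    ∫ y, (y j - μ j) ∂(ellipticalLaw μ S ν) = 0 := by
  have := isProbabilityMeasure_uniformSphere hp
  have h := integral_ellipticalLaw_coord (μ := μ) (S := S) (ν := ν) id measurable_id j
  simp only [id] at h
  rw [h, integral_prod_mul (fun r : ℝ => r)
    (fun u : EuclideanSpace ℝ (Fin p) => inner ℝ (WithLp.toLp 2 (sqrtMatrix S j)) u),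
    integral_inner_uniformSphere hp, mul_zero]

theorem integral_ellipticalLaw_coord_pow (hp : 0 < p) (hS : S.PosSemidef) (j : Fin p) (k : ℕ) :
    ∫ y, (y j - μ j) ^ (2 * k) ∂(ellipticalLaw μ S ν) =
      momentConst p k * scaledMoment p ν k * S j j ^ k := by
  have := isProbabilityMeasure_uniformSphere hp
  rw [integral_ellipticalLaw_coord (fun x => x ^ (2 * k)) (by fun_prop) j]
  simp only [mul_pow]
  rw [integral_prod_mul (fun r : ℝ => r ^ (2 * k))
    (fun u : EuclideanSpace ℝ (Fin p) => inner ℝ (WithLp.toLp 2 (sqrtMatrix S j)) u ^ (2 * k)),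
    integral_inner_pow_uniformSphere hp, pow_mul ‖_‖, sqrtMatrix_row_norm_sq hS, scaledMoment]
  ring

/-- The weight `1 / q` is nonzero, so one infinite moment would make the supremum infinite. -/
theorem hasAllMoments_of_subGaussianNorm_le {Ω : Type*} [MeasurableSpace Ω] {X : Ω → ℝ}
    {P : Measure Ω} (hX : AEStronglyMeasurable X P) {C : ℝ≥0} (h : subGaussianNorm X P ≤ C) :
    HasAllMoments X P := by
  intro q
  rcases Nat.eq_zero_or_pos q with rfl | hq
  · simpa using hX
  refine ⟨hX, ?_⟩
  have h1 : (q : ℝ≥0∞)⁻¹ * eLpNorm X q P ≤ C :=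
    (le_iSup₂ (f := fun (k : ℕ) (_ : 1 ≤ k) => (k : ℝ≥0∞)⁻¹ * eLpNorm X (k : ℝ≥0∞) P) q hq).trans h
  have h2 : (q : ℝ≥0∞)⁻¹ ≠ 0 := by simp
  by_contra h3
  rw [not_lt, top_le_iff] at h3
  rw [h3, ENNReal.mul_top h2] at h1
  exact absurd h1 (by simp)

end Elliptical

/-! ### The normalizing constant -/

theorem momentConst_zero {p : ℕ} (hp : 0 < p) : momentConst p 0 = 1 := by
  have : 0 < Real.Gamma ((p : ℝ) / 2) := Real.Gamma_pos_of_pos (by positivity)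
  simp [momentConst, this.ne']

/-- The functional equation of Gamma gives a factor lying between `1` and `2m + 1` for every `p ≥
1`, hence two-sided bounds uniform in the dimension. -/
theorem momentConst_succ {p : ℕ} (hp : 0 < p) (m : ℕ) :
    momentConst p (m + 1) = momentConst p m * ((2 * m + 1) * p / (p + 2 * m)) := by
  have hp' : (0 : ℝ) < p := by positivity
  have h1 : 0 < Real.Gamma ((p : ℝ) / 2 + m) := Real.Gamma_pos_of_pos (by positivity)
  have h2 : Real.Gamma ((p : ℝ) / 2 + (m + 1 : ℕ)) = (p / 2 + m) * Real.Gamma ((p : ℝ) / 2 + m) := by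
    rw [← Real.Gamma_add_one (by positivity)]; push_cast; ring_nf
  -- For `m = 0` truncated subtraction gives `0‼ = 1`, standing for `(-1)‼`.
  have h3 : (2 * (m + 1) - 1)‼ = (2 * m + 1) * (2 * m - 1)‼ := by
    cases m with
    | zero => rfl
    | succ k => exact Nat.doubleFactorial_add_two (2 * k + 1)
  rw [momentConst, momentConst, h2, h3]
  push_cast
  rw [pow_succ]
  field_simp

theorem one_le_momentConst {p : ℕ} (hp : 0 < p) (m : ℕ) : 1 ≤ momentConst p m := by
  induction m with
  | zero => rw [momentConst_zero hp]
  | succ m ih =>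
    have hp' : (1 : ℝ) ≤ p := by exact_mod_cast hp
    rw [momentConst_succ hp]
    refine one_le_mul_of_one_le_of_one_le ih ?_
    rw [one_le_div (by positivity)]
    nlinarith [(Nat.cast_nonneg m : (0 : ℝ) ≤ m)]

theorem momentConst_le {p : ℕ} (hp : 0 < p) (m : ℕ) :
    momentConst p m ≤ ∏ i ∈ Finset.range m, (2 * (i : ℝ) + 1) := by
  induction m with
  | zero => rw [momentConst_zero hp]; simp
  | succ m ih =>
    have hp' : (1 : ℝ) ≤ p := by exact_mod_cast hp
    rw [momentConst_succ hp, Finset.prod_range_succ]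
    have h : (2 * (m : ℝ) + 1) * p / (p + 2 * m) ≤ 2 * m + 1 := by
      rw [div_le_iff₀ (by positivity)]
      nlinarith [(Nat.cast_nonneg m : (0 : ℝ) ≤ m)]
    exact mul_le_mul ih h (by positivity) (Finset.prod_nonneg fun i _ => by positivity)

/-! ### The estimator as an average of self-normalized moments -/

theorem sampleMean_apply {n p : ℕ} (y : Fin n → EuclideanSpace ℝ (Fin p)) (j : Fin p) :
    sampleMean y j = avg fun i => y i j := by
  simp [sampleMean, avg]

theorem sampleCov_apply_self {n p : ℕ} (y : Fin n → EuclideanSpace ℝ (Fin p)) (j : Fin p) :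
    sampleCov y j j = avg fun i => (y i j - avg fun i => y i j) ^ 2 := by
  simp [sampleCov, avg, Matrix.sum_apply, Matrix.vecMulVec_apply, sampleMean_apply, sq]

theorem marginalAggregation_eq {n p : ℕ} (hn : 0 < n) (m : ℕ)
    (y : Fin n → EuclideanSpace ℝ (Fin p)) :
    marginalAggregation m y (sampleMean y) (fun j => sampleCov y j j) =
      (momentConst p m)⁻¹ * avg fun j => selfNormalizedMoment m fun i => y i j := by
  have hn' : (n : ℝ) ≠ 0 := by positivity
  have h : ∀ j, 1 / sampleCov y j j ^ m * ∑ i, (y i j - sampleMean y j) ^ (2 * m) =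
      n * selfNormalizedMoment m fun i => y i j := by
    intro j
    have hsum : ∑ i, (y i j - avg fun i => y i j) ^ (2 * m) =
        n * avg fun i => (y i j - avg fun i => y i j) ^ (2 * m) := (mul_inv_cancel_left₀ hn' _).symm
    rw [sampleCov_apply_self, sampleMean_apply, selfNormalizedMoment, hsum]
    ring
  rw [marginalAggregation]
  simp only [h]
  rw [← Finset.mul_sum, avg, one_div, mul_inv, mul_inv]
  field_simp

/-- Centring removes the shift, and numerator and denominator are both homogeneous of degree `2m`.
-/
theorem selfNormalizedMoment_affine {n : ℕ} (hn : 0 < n) (m : ℕ) (y : Fin n → ℝ) (a : ℝ) {s : ℝ}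
    (hs : s ≠ 0) :
    selfNormalizedMoment m (fun i => s * (y i - a)) = selfNormalizedMoment m y := by
  have h : ∀ i, s * (y i - a) - avg (fun i => s * (y i - a)) = s * (y i - avg y) := by
    intro i; rw [avg_const_mul, avg_sub, avg_const hn]; ring
  rw [selfNormalizedMoment]
  simp only [h]
  simp only [mul_pow, avg_const_mul, ← pow_mul, selfNormalizedMoment]
  exact mul_div_mul_left _ _ (pow_ne_zero _ hs)

/-! ### The rate of convergence -/

theorem theorem1
    (m : ℕ) (hm : 1 ≤ m)
    -- the dimension, as a function of the sample size `n`
    (p : ℕ → ℕ) (hp : ∀ n, 0 < p n)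
    (hlog : (fun n => Real.log (p n) ^ 2) =o[atTop] (fun n => (n : ℝ)))
    -- mean vector, covariance matrix, and law of the radial variable `ξ`
    (μ : ∀ n, EuclideanSpace ℝ (Fin (p n)))
    (S : ∀ n, Matrix (Fin (p n)) (Fin (p n)) ℝ)
    (hS : ∀ n, (S n).PosSemidef) (hdiag : ∀ n j, 0 < S n j j)
    (ν : ℕ → Measure ℝ) [∀ n, IsProbabilityMeasure (ν n)]
    (hν : ∀ n, ν n (Set.Iio 0) = 0)
    (hν2 : ∀ n, ∫ r, r ^ 2 ∂(ν n) = p n)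
    -- uniform marginal sub-Gaussianity, and `θ_{2m}` of constant scale
    (C : ℝ≥0)
    (hsub : ∀ n (j : Fin (p n)),
      subGaussianNorm (fun y => y j - μ n j) (ellipticalLaw (μ n) (S n) (ν n)) ≤ C)
    (K : ℝ) (hθ : ∀ n, scaledMoment (p n) (ν n) (2 * m) ≤ K)
    -- `n` i.i.d. samples
    {Ω : ℕ → Type*} [∀ n, MeasurableSpace (Ω n)]
    (P : ∀ n, Measure (Ω n)) [∀ n, IsProbabilityMeasure (P n)]
    (Y : ∀ n, Fin n → Ω n → EuclideanSpace ℝ (Fin (p n)))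
    (hlaw : ∀ n i, HasLaw (Y n i) (ellipticalLaw (μ n) (S n) (ν n)) (P n))
    (hindep : ∀ n, iIndepFun (Y n) (P n)) :
    IsBigOInProbability P
      (fun n ω =>
        marginalAggregation m (fun i => Y n i ω)
            (sampleMean (fun i => Y n i ω)) (fun j => sampleCov (fun i => Y n i ω) j j)
          - scaledMoment (p n) (ν n) m)
      (fun n => (n : ℝ) ^ (-(1 / 2) : ℝ)) := by
  -- A bound for `c_{2m} θ_{2m}`, the standardized moment of order `4m`, free of `n` and of the
  -- coordinate.
  set A : ℝ := (∏ i ∈ Finset.range (2 * m), (2 * (i : ℝ) + 1)) * |K| with hA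
  obtain ⟨C₀, hC₀, hone⟩ := exists_abs_selfNormalizedMoment_sub_le_of_iIndepFun hm A
  have key : ∀ n, 0 < n → ∃ D : Ω n → ℝ, Integrable D (P n) ∧ ∫ ω, D ω ∂(P n) ≤ C₀ / √n ∧
      ∀ ω, |marginalAggregation m (fun i => Y n i ω) (sampleMean (fun i => Y n i ω))
        (fun j => sampleCov (fun i => Y n i ω) j j) - scaledMoment (p n) (ν n) m| ≤ D ω := by
    intro n hn
    have hc := one_le_momentConst (hp n) m
    set c := momentConst (p n) m with hcdef
    set θ := scaledMoment (p n) (ν n) m with hθdef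
    have hj : ∀ j : Fin (p n), ∃ D : Ω n → ℝ, Integrable D (P n) ∧ ∫ ω, D ω ∂(P n) ≤ C₀ / √n ∧
        ∀ ω, |selfNormalizedMoment m (fun i => Y n i ω j) - c * θ| ≤ D ω := by
      intro j
      have hs : √(S n j j) ≠ 0 := (Real.sqrt_pos.2 (hdiag n j)).ne'
      have hs2 : ∀ k, ((√(S n j j))⁻¹) ^ (2 * k) * S n j j ^ k = 1 := fun k => by
        rw [pow_mul, ← mul_pow, inv_pow, Real.sq_sqrt (hdiag n j).le,
          inv_mul_cancel₀ (hdiag n j).ne', one_pow]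
      have hmeas : Measurable fun y : EuclideanSpace ℝ (Fin (p n)) => y j - μ n j := by fun_prop
      have hall : ∀ i, HasAllMoments (fun ω => Y n i ω j - μ n j) (P n) := fun i q => by
        have h := hasAllMoments_of_subGaussianNorm_le hmeas.aestronglyMeasurable (hsub n j) q
        rw [← (hlaw n i).map_eq] at h
        exact (memLp_map_measure_iff hmeas.aestronglyMeasurable (hlaw n i).aemeasurable).1 h
      have hpow : ∀ i k, ∫ ω, ((√(S n j j))⁻¹ * (Y n i ω j - μ n j)) ^ (2 * k) ∂(P n) =
          momentConst (p n) k * scaledMoment (p n) (ν n) k := fun i k => by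
        have h := (hlaw n i).integral_comp
          (f := fun y : EuclideanSpace ℝ (Fin (p n)) => (y j - μ n j) ^ (2 * k))
          (hmeas.pow_const _).aestronglyMeasurable
        rw [integral_ellipticalLaw_coord_pow (hp n) (hS n)] at h
        simp only [mul_pow, integral_const_mul]
        simp only [Function.comp_def] at h
        rw [h, mul_comm, mul_assoc, mul_comm (S n j j ^ k), hs2, mul_one]
      obtain ⟨D, hD, hDC, hle⟩ := hone (P n) (fun i ω => (√(S n j j))⁻¹ * (Y n i ω j - μ n j)) (c * θ)
        hn (fun i => (hall i).const_mul _)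
        ((hindep n).comp (fun _ y => (√(S n j j))⁻¹ * (y j - μ n j)) fun _ => hmeas.const_mul _)
        (fun i => by
          have h := (hlaw n i).integral_comp
            (f := fun y : EuclideanSpace ℝ (Fin (p n)) => y j - μ n j) hmeas.aestronglyMeasurable
          rw [integral_ellipticalLaw_coord_sub (hp n)] at h
          simp only [Function.comp_def] at h
          rw [integral_const_mul, h, mul_zero])
        (fun i => by
          -- Unit variance: `c_1 = 1`, and `θ_1 = 1` because `E ξ² = p`.
          have hp' : (p n : ℝ) ≠ 0 := by exact_mod_cast (hp n).ne'
          have h := hpow i 1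
          rw [mul_one, momentConst_succ (hp n), momentConst_zero (hp n), scaledMoment, mul_one,
            hν2] at h
          rw [h]
          simp [hp'])
        (fun i => hpow i m)
        (fun i => by
          rw [hpow i (2 * m)]
          calc _ ≤ momentConst (p n) (2 * m) * |K| := by
                gcongr
                · exact zero_le_one.trans (one_le_momentConst (hp n) _)
                · exact (hθ n).trans (le_abs_self K)
            _ ≤ A := by
                rw [hA]
                gcongr
                exact momentConst_le (hp n) _)
      refine ⟨D, hD, hDC, fun ω => ?_⟩
      rw [← selfNormalizedMoment_affine hn m (fun i => Y n i ω j) (μ n j) (inv_ne_zero hs)]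
      exact hle ω
    choose D hD hDC hle using hj
    -- Averaging the dominating variables needs no information on the joint law of the coordinates;
    -- dividing by `c ≥ 1` does not enlarge the error.
    refine ⟨fun ω => avg fun j => D j ω, ?_, ?_, fun ω => ?_⟩
    · exact (integrable_finsetSum _ fun j _ => hD j).const_mul _
    · simp only [avg]
      rw [integral_const_mul, integral_finsetSum _ fun j _ => hD j]
      exact (avg_mono hDC).trans_eq (avg_const (hp n) _)
    · rw [marginalAggregation_eq hn]
      have hc0 : 0 < c := by linarith
      have e : c⁻¹ * (avg fun j => selfNormalizedMoment m fun i => Y n i ω j) - θ =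
          c⁻¹ * avg fun j => (selfNormalizedMoment m fun i => Y n i ω j) - c * θ := by
        rw [avg_sub, avg_const (hp n)]; field_simp
      rw [e, abs_mul, abs_of_pos (inv_pos.2 hc0)]
      calc _ ≤ 1 * |avg fun j => (selfNormalizedMoment m fun i => Y n i ω j) - c * θ| := by
            gcongr
            exact inv_le_one_of_one_le₀ hc
        _ ≤ _ := by
            rw [one_mul]
            exact (abs_avg_le _).trans (avg_mono fun j => hle j ω)
  intro ε hε
  -- The constant from Markov's inequality; the `+ 1` keeps it positive when `C₀ = 0`.
  refine ⟨(C₀ + 1) / ε, by positivity, ?_⟩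
  filter_upwards [eventually_gt_atTop 0] with n hn
  obtain ⟨D, hD, hDC, hle⟩ := key n hn
  have hn' : (0 : ℝ) < √n := by positivity
  have hrate : (n : ℝ) ^ (-(1 / 2) : ℝ) = (√n)⁻¹ := by
    rw [Real.rpow_neg (by positivity), Real.sqrt_eq_rpow]
  rw [hrate]
  set x : ℝ := (C₀ + 1) / ε * (√n)⁻¹ with hx
  have hx0 : 0 < x := by positivity
  have hmarkov := mul_meas_ge_le_integral_of_nonneg
    (Eventually.of_forall fun ω => (abs_nonneg _).trans (hle ω)) hD x
  have hreal : (P n).real {ω | x ≤ D ω} ≤ ε := by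
    have h1 : x * (P n).real {ω | x ≤ D ω} ≤ x * ε := by
      calc _ ≤ C₀ / √n := hmarkov.trans hDC
        _ ≤ (C₀ + 1) / √n := by gcongr; linarith
        _ = _ := by rw [hx]; field_simp
    exact le_of_mul_le_mul_left h1 hx0
  calc _ ≤ P n {ω | x ≤ D ω} := measure_mono fun ω hω => (le_of_lt hω).trans (hle ω)
    _ = ENNReal.ofReal ((P n).real {ω | x ≤ D ω}) := by simp
    _ ≤ _ := ENNReal.ofReal_le_ofReal hreal
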